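/- Let $a\in\mathbb R$, $\ell>0$, $\delta\ge 0$, and let $\Pi$ be a determinantal point process on the interval $I=[a,a+\ell]$ with a (real- or complex-valued) $C^2$ kernel $K:I^2\to\mathbb C$; that is, $\Pi$ is a random finite subset of $I$ such that for every $k\ge 0$ and every Borel set $B\subseteq I^k$, the expected number of $k$-tuples $(x_1,\dots,x_k)\in B$ of distinct points of $\Pi$ equals $\int_B\det\big(K(x_i,x_j)\big)_{i,j=1}^k\,dx_1\cdots dx_k$, the determinant being real and nonnegative for almost every $(x_1,\dots,x_k)\in I^k$. Suppose that there is a constant $b$ such that for all $(x,y)\in I^2$, $$|K(x,y)|\le b,\qquad |\partial_xK(x,y)|\le b^2,\qquad |\partial_yK(x,y)|\le b^2,\qquad |\partial_{x}\partial_{y}K(x,y)|\le b^3,$$ where derivatives at the boundary of $I^2$ are one-sided. Call a point $x\in\Pi$ $\delta$-jammed if there is another point $y\in\Pi$, $y\ne x$, with $|x-y|\le\delta$, and let $L$ be the number of $\delta$-jammed points of $\Pi$. Then for every integer $n\ge 0$, $$\mathbb E\left[\binom{\lfloor L/3\rfloor}{n}\,n!\right]\le\left(4nb^4\delta^3\ell\right)^n,$$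 with the conventions $\binom mn=0$ for $n>m$ and $0^0=1$. -/

import Mathlib

open MeasureTheory Set
open scoped ENNReal NNReal Nat

/-- A (simple) point process on a compact set `I ⊆ ℝ`: a random finite subset `X` of `I`, measurable
in the sense that the number of points in each Borel set is a random variable. -/
structure IsPointProcessOn {Ω : Type*} [MeasurableSpace Ω] (I : Set ℝ) (X : Ω → Finset ℝ) :
    Prop where
  subset : ∀ ω, (X ω : Set ℝ) ⊆ I
  measurable_count : ∀ B : Set ℝ, MeasurableSet B →
    Measurable fun ω => ((X ω : Set ℝ) ∩ B).ncard

/-- The set of ordered `k`-tuples of distinct points of the configuration `s` that lie in `B`. -/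
def distinctTuples (s : Finset ℝ) (k : ℕ) (B : Set (Fin k → ℝ)) : Set (Fin k → ℝ) :=
  {x | x ∈ B ∧ Function.Injective x ∧ ∀ i, x i ∈ s}

/-- `ρ` is a `k`-point correlation function (joint intensity) on `I` of the point process `X`:
it is the density, with respect to Lebesgue measure on `I ^ k`, of the `k`-th factorial moment
measure `B ↦ 𝔼 #{k-tuples of distinct points of X in B}`. -/
def IsCorrelationFunction {Ω : Type*} [MeasurableSpace Ω] (P : Measure Ω) (I : Set ℝ)
    (X : Ω → Finset ℝ) (k : ℕ) (ρ : (Fin k → ℝ) → ℝ≥0) : Prop :=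
  Measurable ρ ∧ ∀ B : Set (Fin k → ℝ), MeasurableSet B →
    ∫⁻ ω, ((distinctTuples (X ω) k B).ncard : ℝ≥0∞) ∂P
      = ∫⁻ x in B ∩ Set.univ.pi (fun _ => I), (ρ x : ℝ≥0∞)

/-- `X` is a determinantal point process on `I` with (real or complex) kernel `K`: it is a point
process on `I`, and for every `k` the determinant `det (K (x i) (x j))` is its `k`-point correlation
function. -/
structure IsDeterminantalOn {𝕜 : Type*} [RCLike 𝕜] {Ω : Type*} [MeasurableSpace Ω]
    (P : Measure Ω) (I : Set ℝ) (K : ℝ → ℝ → 𝕜) (X : Ω → Finset ℝ) : Prop where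
  isPointProcessOn : IsPointProcessOn I X
  correlation : ∀ k : ℕ, ∃ ρ : (Fin k → ℝ) → ℝ≥0, IsCorrelationFunction P I X k ρ ∧
    ∀ᵐ x ∂(volume.restrict (Set.univ.pi fun _ : Fin k => I)),
      (Matrix.of fun i j => K (x i) (x j)).det = (((ρ x : ℝ≥0) : ℝ) : 𝕜)

/-- The `δ`-jammed points of a configuration `s`: those points of `s` that have another point of `s`
at distance at most `δ`. -/
def jammedPoints (δ : ℝ) (s : Finset ℝ) : Set ℝ :=
  {x | x ∈ s ∧ ∃ y ∈ s, y ≠ x ∧ |x - y| ≤ δ}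

/-! Among L jammed points there are at least L/3 disjoint close pairs (`exists_isCloseMatching`). So
the random variable is at most the number of 2n-tuples of distinct points made of n close pairs,
whose mean is the integral of a 2n × 2n kernel determinant over `closePairs`. Repulsion makes that
determinant small. Subtracting, within each pair, one row and column from the other turns entries
into first and mixed differences of K, which gain a factor bδ per altered index. Hadamard's bound
then gives (2nb⁴δ²)^n (`norm_det_kernel_sum_le`). The domain has volume at most (2δℓ)^n, and the
product of the two bounds is the claim. -/

/-- A family of pairwise disjoint pairs of distinct points of `s` at distance at most `δ`. -/
structure IsCloseMatching (δ : ℝ) (s : Finset ℝ) (M : Finset (ℝ × ℝ)) : Prop where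
  fst_mem : ∀ p ∈ M, p.1 ∈ s
  snd_mem : ∀ p ∈ M, p.2 ∈ s
  fst_ne_snd : ∀ p ∈ M, ∀ q ∈ M, p.1 ≠ q.2
  fst_inj : ∀ p ∈ M, ∀ q ∈ M, p.1 = q.1 → p = q
  snd_inj : ∀ p ∈ M, ∀ q ∈ M, p.2 = q.2 → p = q
  close : ∀ p ∈ M, |p.1 - p.2| ≤ δ

/-! ### Extracting disjoint close pairs. -/

lemma jammedPoints_finite (δ : ℝ) (s : Finset ℝ) : (jammedPoints δ s).Finite :=
  s.finite_toSet.subset fun _ hx => hx.1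

/-- Deleting the two leftmost jammed points unjams at most one further point. -/
lemma exists_jammed_pair_erase (δ : ℝ) (s : Finset ℝ) (hs : (jammedPoints δ s).Nonempty) :
    ∃ x ∈ s, ∃ y ∈ s, x ≠ y ∧ |x - y| ≤ δ ∧
      ∃ w, jammedPoints δ s ⊆ insert x (insert y (insert w (jammedPoints δ (s \ {x, y})))) := by
  obtain ⟨x, hx, hxmin⟩ := exists_min_image _ id (jammedPoints_finite δ s) hs
  obtain ⟨z, hz, hzx, hxz⟩ := hx.2
  have hzJ : z ∈ jammedPoints δ s := ⟨hz, x, hx.1, hzx.symm, by rwa [abs_sub_comm]⟩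
  obtain ⟨y, hy, hymin⟩ := exists_min_image (jammedPoints δ s \ {x}) id
    ((jammedPoints_finite δ s).sdiff) ⟨z, hzJ, hzx⟩
  have hyz : y ≤ z := hymin z ⟨hzJ, hzx⟩
  have hxy : x ≤ y := hxmin y hy.1
  have hyx : y ≠ x := hy.2
  have hxyδ : |x - y| ≤ δ := by
    rw [abs_le] at hxz ⊢
    constructor <;> linarith
  refine ⟨x, hx.1, y, hy.1.1, hyx.symm, hxyδ, ?_⟩
  by_cases hne : (jammedPoints δ s \ {x, y}).Nonempty
  · obtain ⟨w, hw, hwmin⟩ := exists_min_image (jammedPoints δ s \ {x, y}) id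
      ((jammedPoints_finite δ s).sdiff) hne
    have hwxy : w ≠ x ∧ w ≠ y := by simpa using hw.2
    refine ⟨w, fun v hv => ?_⟩
    by_cases h1 : v = x
    · simp [h1]
    by_cases h2 : v = y
    · simp [h2]
    by_cases h3 : v = w
    · simp [h3]
    refine Or.inr (Or.inr (Or.inr ?_))
    have hwv : w ≤ v := hwmin v ⟨hv, by simp [h1, h2]⟩
    have hyw : y ≤ w := hymin w ⟨hw.1, hwxy.1⟩
    obtain ⟨u, hu, huv, hvu⟩ := hv.2
    have hvs : v ∈ s \ {x, y} := by simp [hv.1, h1, h2]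
    by_cases hu' : u = x ∨ u = y
    -- Here v loses its neighbour u, but u ≤ y ≤ w ≤ v, so w is at least as close to v and survives
    -- the deletion.
    · have huy : u ≤ y := by rcases hu' with rfl | rfl <;> [exact hxy; exact le_rfl]
      refine ⟨hvs, w, by simp [hw.1.1, hwxy], Ne.symm h3, ?_⟩
      rw [abs_le] at hvu ⊢
      constructor <;> linarith
    · exact ⟨hvs, u, by simpa [hu] using hu', huv, hvu⟩
  -- Only x and y are jammed, so the third point is a dummy.
  · refine ⟨x, fun v hv => ?_⟩
    by_contra hcon
    simp only [mem_insert_iff, not_or] at hcon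
    exact hne ⟨v, hv, by simp [hcon.1, hcon.2.1]⟩

/-- Greedy induction: each extracted pair costs at most three jammed points, namely x, y and the one
point w that may become unjammed. -/
lemma exists_isCloseMatching (δ : ℝ) (s : Finset ℝ) :
    ∃ M, IsCloseMatching δ s M ∧ (jammedPoints δ s).ncard ≤ 3 * M.card := by
  classical
  induction s using Finset.strongInduction with
  | H s ih =>
    rcases (jammedPoints δ s).eq_empty_or_nonempty with h0 | hne
    · exact ⟨∅, by constructor <;> simp, by simp [h0]⟩
    obtain ⟨x, hx, y, hy, hxy, hclose, w, hsub⟩ := exists_jammed_pair_erase δ s hne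
    obtain ⟨M, hM, hcard⟩ := ih (s \ {x, y})
      (Finset.sdiff_ssubset (by intro v; simp; rintro (rfl | rfl) <;> assumption) (by simp))
    have h1 : ∀ p ∈ M, p.1 ∈ s ∧ p.1 ≠ x ∧ p.1 ≠ y := fun p hp => by
      simpa using hM.fst_mem p hp
    have h2 : ∀ p ∈ M, p.2 ∈ s ∧ p.2 ≠ x ∧ p.2 ≠ y := fun p hp => by
      simpa using hM.snd_mem p hp
    have hnot : (x, y) ∉ M := fun h => (h1 _ h).2.1 rfl
    refine ⟨insert (x, y) M, ?_, ?_⟩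
    · constructor
      · simp only [Finset.forall_mem_insert]
        exact ⟨hx, fun p hp => (h1 p hp).1⟩
      · simp only [Finset.forall_mem_insert]
        exact ⟨hy, fun p hp => (h2 p hp).1⟩
      · simp only [Finset.forall_mem_insert]
        exact ⟨⟨hxy, fun q hq => (h2 q hq).2.1.symm⟩,
          fun p hp => ⟨(h1 p hp).2.2, hM.fst_ne_snd p hp⟩⟩
      · simp only [Finset.forall_mem_insert]
        exact ⟨⟨fun _ => trivial, fun q hq h => absurd h.symm (h1 q hq).2.1⟩,
          fun p hp => ⟨fun h => absurd h (h1 p hp).2.1, hM.fst_inj p hp⟩⟩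
      · simp only [Finset.forall_mem_insert]
        exact ⟨⟨fun _ => trivial, fun q hq h => absurd h.symm (h2 q hq).2.2⟩,
          fun p hp => ⟨fun h => absurd h (h2 p hp).2.2, hM.snd_inj p hp⟩⟩
      · simp only [Finset.forall_mem_insert]
        exact ⟨hclose, hM.close⟩
    · rw [Finset.card_insert_of_notMem hnot]
      have hfin := jammedPoints_finite δ (s \ {x, y})
      have := ncard_le_ncard hsub (((hfin.insert _).insert _).insert _)
      have a1 := ncard_insert_le x (insert y (insert w (jammedPoints δ (s \ {x, y}))))
      have a2 := ncard_insert_le y (insert w (jammedPoints δ (s \ {x, y})))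
      have a3 := ncard_insert_le w (jammedPoints δ (s \ {x, y}))
      omega

/-! ### From pairs to tuples of distinct points. -/

/-- The `2n`-tuples whose `i`-th and `(n + i)`-th entries are at distance at most `δ`. -/
def closePairs (n : ℕ) (δ : ℝ) : Set (Fin (n + n) → ℝ) :=
  {x | ∀ i, |x (Fin.castAdd n i) - x (Fin.natAdd n i)| ≤ δ}

lemma measurableSet_closePairs (n : ℕ) (δ : ℝ) : MeasurableSet (closePairs n δ) := by
  have : IsClosed (closePairs n δ) := by
    simp only [closePairs, ofPred_forall]
    exact isClosed_iInter fun i => isClosed_le (by fun_prop) continuous_const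
  exact this.measurableSet

lemma distinctTuples_finite (s : Finset ℝ) (k : ℕ) (B : Set (Fin k → ℝ)) :
    (distinctTuples s k B).Finite :=
  (Set.Finite.pi fun _ : Fin k => s.finite_toSet).subset fun _ hx i _ => hx.2.2 i

/-- An ordered choice of n pairs of M lists n first points followed by n second points. Disjointness
makes the entries distinct, and the first points alone recover the pairs. -/
lemma IsCloseMatching.descFactorial_le {δ : ℝ} {s : Finset ℝ} {M : Finset (ℝ × ℝ)}
    (hM : IsCloseMatching δ s M) (n : ℕ) :
    M.card.descFactorial n ≤ (distinctTuples s (n + n) (closePairs n δ)).ncard := by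
  classical
  have hcard : M.card.descFactorial n = (univ : Set (Fin n ↪ M)).ncard := by
    rw [ncard_univ, Nat.card_eq_fintype_card, Fintype.card_embedding_eq]
    simp
  rw [hcard]
  refine ncard_le_ncard_of_injOn
    (fun f => Fin.append (fun i => (f i).1.1) (fun i => (f i).1.2)) ?_ ?_
    (distinctTuples_finite _ _ _)
  · intro f _
    refine ⟨fun i => by
      simpa [-Fin.natAdd_eq_addNat] using hM.close _ (f i).2, ?_, ?_⟩
    · rw [Fin.append_injective_iff]
      refine ⟨fun i j h => f.injective (Subtype.ext (hM.fst_inj _ (f i).2 _ (f j).2 h)),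
        fun i j h => f.injective (Subtype.ext (hM.snd_inj _ (f i).2 _ (f j).2 h)),
        fun i j => hM.fst_ne_snd _ (f i).2 _ (f j).2⟩
    · intro i
      refine Fin.addCases (fun i => ?_) (fun i => ?_) i
      · simpa using hM.fst_mem _ (f i).2
      · simpa [-Fin.natAdd_eq_addNat] using hM.snd_mem _ (f i).2
  · intro f _ g _ h
    ext i : 1
    refine Subtype.ext (hM.fst_inj _ (f i).2 _ (g i).2 ?_)
    simpa using congrFun h (Fin.castAdd n i)

lemma choose_jammedPoints_mul_factorial_le (δ : ℝ) (s : Finset ℝ) (n : ℕ) :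
    ((jammedPoints δ s).ncard / 3).choose n * n !
      ≤ (distinctTuples s (n + n) (closePairs n δ)).ncard := by
  obtain ⟨M, hM, hcard⟩ := exists_isCloseMatching δ s
  rw [mul_comm, ← Nat.descFactorial_eq_factorial_mul_choose]
  exact (Nat.descFactorial_le n (by omega)).trans (hM.descFactorial_le n)

/-! ### Determinant bounds of Hadamard type. -/

lemma Finset.prod_le_sum_div_card_pow {ι : Type*} [Fintype ι] (z : ι → ℝ) (hz : ∀ i, 0 ≤ z i) :
    ∏ i, z i ≤ ((∑ i, z i) / Fintype.card ι) ^ Fintype.card ι := by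
  rcases isEmpty_or_nonempty ι with h | h
  · simp
  have hc : (0 : ℝ) < Fintype.card ι := by exact_mod_cast Fintype.card_pos
  have := Real.geom_mean_le_arith_mean Finset.univ (fun _ => 1) z (by simp) (by simpa using hc)
    (fun i _ => hz i)
  simp only [Real.rpow_one, one_mul, Finset.sum_const, nsmul_eq_mul, mul_one,
    Finset.card_univ] at this
  have h0 : 0 ≤ ∏ i, z i := Finset.prod_nonneg fun i _ => hz i
  calc ∏ i, z i = ((∏ i, z i) ^ ((Fintype.card ι : ℝ)⁻¹)) ^ Fintype.card ι := by
        rw [Real.rpow_inv_natCast_pow h0 Fintype.card_ne_zero]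
    _ ≤ _ := by gcongr

namespace Matrix

open scoped ComplexOrder

variable {𝕜 ι : Type*} [RCLike 𝕜] [Fintype ι] [DecidableEq ι]

/-- AM–GM on the eigenvalues; applied to A * Aᴴ it yields Hadamard's bound. -/
lemma PosSemidef.norm_det_le {G : Matrix ι ι 𝕜} (hG : G.PosSemidef) :
    ‖G.det‖ ≤ (‖G.trace‖ / Fintype.card ι) ^ Fintype.card ι := by
  have h0 := hG.eigenvalues_nonneg
  rw [hG.1.det_eq_prod_eigenvalues, hG.1.trace_eq_sum_eigenvalues, norm_prod, ← RCLike.ofReal_sum,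
    RCLike.norm_of_nonneg (Finset.sum_nonneg fun i _ => h0 i)]
  simp_rw [RCLike.norm_of_nonneg (h0 _)]
  exact Finset.prod_le_sum_div_card_pow _ h0

/-- Hadamard's bound for matrices with bounded entries. -/
lemma norm_det_sq_le {A : Matrix ι ι 𝕜} {c : ℝ} (hA : ∀ i j, ‖A i j‖ ≤ c) :
    ‖A.det‖ ^ 2 ≤ (Fintype.card ι * c ^ 2) ^ Fintype.card ι := by
  rcases isEmpty_or_nonempty ι with h | h
  · simp
  have hc : (0 : ℝ) < Fintype.card ι := by exact_mod_cast Fintype.card_pos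
  have h1 := (posSemidef_self_mul_conjTranspose A).norm_det_le
  rw [det_mul, det_conjTranspose, norm_mul, norm_star, ← sq] at h1
  refine h1.trans ?_
  gcongr
  rw [div_le_iff₀ hc]
  have : ‖(A * Aᴴ).trace‖ ≤ ∑ _i : ι, ∑ _j : ι, c ^ 2 := by
    simp only [trace, diag_apply, mul_apply, conjTranspose_apply]
    refine norm_sum_le_of_le _ fun i _ => norm_sum_le_of_le _ fun j _ => ?_
    rw [norm_mul, norm_star, ← sq]
    have := hA i j
    gcongr
  refine this.trans (le_of_eq ?_)
  simp
  ring

lemma norm_det_sq_le_of_scaled {A : Matrix ι ι 𝕜} {c : ℝ} {r : ι → ℝ} (hr : ∀ i, 0 ≤ r i)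
    (hA : ∀ i j, ‖A i j‖ ≤ c * (r i * r j)) :
    ‖A.det‖ ^ 2 ≤ (Fintype.card ι * c ^ 2) ^ Fintype.card ι * ((∏ i, r i) ^ 2) ^ 2 := by
  -- A vanishing weight, as when δ = 0, forbids the rescaling below but forces a zero row.
  by_cases h0 : ∃ i, r i = 0
  · obtain ⟨i, hi⟩ := h0
    rw [det_eq_zero_of_row_eq_zero i fun j => norm_le_zero_iff.1 (by simpa [hi] using hA i j)]
    simp
    positivity
  push Not at h0
  have hpos : ∀ i, 0 < r i := fun i => (hr i).lt_of_ne (h0 i).symm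
  set A' : Matrix ι ι 𝕜 := of fun i j => A i j / ((r i : 𝕜) * (r j : 𝕜)) with hA'
  have hne : ∀ i, (r i : 𝕜) ≠ 0 := fun i => by exact_mod_cast h0 i
  have hfac : A = diagonal (fun i => (r i : 𝕜)) * A' * diagonal (fun i => (r i : 𝕜)) := by
    ext i j
    rw [mul_diagonal, diagonal_mul, hA', of_apply]
    field_simp [hne i, hne j]
  have hbd : ‖A'.det‖ ^ 2 ≤ (Fintype.card ι * c ^ 2) ^ Fintype.card ι := by
    refine norm_det_sq_le fun i j => ?_
    rw [hA', of_apply, norm_div, norm_mul, RCLike.norm_of_nonneg (hr i), RCLike.norm_of_nonneg (hr j),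
      div_le_iff₀ (mul_pos (hpos i) (hpos j))]
    exact hA i j
  have hn : ‖A.det‖ = ‖A'.det‖ * (∏ i, r i) ^ 2 := by
    rw [hfac, det_mul, det_mul, det_diagonal, norm_mul, norm_mul, norm_prod]
    simp_rw [RCLike.norm_of_nonneg (hr _)]
    ring
  rw [hn, mul_pow]
  gcongr

end Matrix

/-! ### Mean value bounds for differences of the kernel. -/

section Differences

variable {𝕜 : Type*} [RCLike 𝕜] {I : Set ℝ} {K : ℝ → ℝ → 𝕜}

lemma hasDerivWithinAt_left (hK : DifferentiableOn ℝ (fun p : ℝ × ℝ => K p.1 p.2) (I ×ˢ I))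
    {x y : ℝ} (hx : x ∈ I) (hy : y ∈ I) :
    HasDerivWithinAt (fun s => K s y)
      (fderivWithin ℝ (fun p : ℝ × ℝ => K p.1 p.2) (I ×ˢ I) (x, y) (1, 0)) I x := by
  have h1 := (hK (x, y) ⟨hx, hy⟩).hasFDerivWithinAt
  have h2 : HasDerivWithinAt (fun s : ℝ => (s, y)) ((1 : ℝ), (0 : ℝ)) I x :=
    (hasDerivWithinAt_id x I).prodMk (hasDerivWithinAt_const x I y)
  exact h1.comp_hasDerivWithinAt x h2 fun s hs => show (s, y) ∈ I ×ˢ I from ⟨hs, hy⟩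

lemma differentiableOn_right (hK : DifferentiableOn ℝ (fun p : ℝ × ℝ => K p.1 p.2) (I ×ˢ I))
    {x : ℝ} (hx : x ∈ I) : DifferentiableOn ℝ (fun t => K x t) I :=
  hK.comp (f := fun t : ℝ => (x, t)) (by fun_prop) fun _ ht => ⟨hx, ht⟩

/-- This is where second-order smoothness enters: the total derivative is C¹, and the x-partial is
its value at (1, 0). -/
lemma differentiableOn_derivWithin_left (hI : UniqueDiffOn ℝ I)
    (hK : ContDiffOn ℝ 2 (fun p : ℝ × ℝ => K p.1 p.2) (I ×ˢ I)) {x : ℝ} (hx : x ∈ I) :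
    DifferentiableOn ℝ (fun t => derivWithin (fun s => K s t) I x) I := by
  have h1 : DifferentiableOn ℝ (fderivWithin ℝ (fun p : ℝ × ℝ => K p.1 p.2) (I ×ˢ I)) (I ×ˢ I) :=
    (hK.fderivWithin (m := 1) (hI.prod hI) (by norm_num)).differentiableOn one_ne_zero
  have h2 : DifferentiableOn ℝ
      (fun t => fderivWithin ℝ (fun p : ℝ × ℝ => K p.1 p.2) (I ×ˢ I) (x, t) (1, 0)) I :=
    (h1.comp (f := fun t : ℝ => (x, t)) (by fun_prop) fun _ ht => ⟨hx, ht⟩).clm_apply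
      (differentiableOn_const _)
  refine h2.congr fun t ht => ?_
  exact (hasDerivWithinAt_left (hK.differentiableOn two_ne_zero) hx ht).derivWithin (hI x hx)

lemma norm_sub_left_le (hI : Convex ℝ I)
    (hK : DifferentiableOn ℝ (fun p : ℝ × ℝ => K p.1 p.2) (I ×ˢ I)) {C : ℝ}
    (hC : ∀ x ∈ I, ∀ y ∈ I, ‖derivWithin (fun s => K s y) I x‖ ≤ C)
    {x x' y : ℝ} (hx : x ∈ I) (hx' : x' ∈ I) (hy : y ∈ I) :
    ‖K x' y - K x y‖ ≤ C * |x' - x| :=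
  hI.norm_image_sub_le_of_norm_derivWithin_le (f := fun s => K s y)
    (fun _ hs => (hasDerivWithinAt_left hK hs hy).differentiableWithinAt)
    (fun s hs => hC s hs y hy) hx hx'

lemma norm_sub_right_le (hI : Convex ℝ I)
    (hK : DifferentiableOn ℝ (fun p : ℝ × ℝ => K p.1 p.2) (I ×ˢ I)) {C : ℝ}
    (hC : ∀ x ∈ I, ∀ y ∈ I, ‖derivWithin (fun t => K x t) I y‖ ≤ C)
    {x y y' : ℝ} (hx : x ∈ I) (hy : y ∈ I) (hy' : y' ∈ I) :
    ‖K x y' - K x y‖ ≤ C * |y' - y| :=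
  hI.norm_image_sub_le_of_norm_derivWithin_le (f := fun t => K x t)
    (differentiableOn_right hK hx) (fun t ht => hC x hx t ht) hy hy'

/-- Mean value inequality twice: in x for `K s y' - K s y`, whose derivative is in turn bounded by
the inequality in y for the x-partial. -/
lemma norm_mixed_sub_le (hI : Convex ℝ I) (hI' : UniqueDiffOn ℝ I)
    (hK : ContDiffOn ℝ 2 (fun p : ℝ × ℝ => K p.1 p.2) (I ×ˢ I)) {C : ℝ}
    (hC : ∀ x ∈ I, ∀ y ∈ I,
      ‖derivWithin (fun t => derivWithin (fun s => K s t) I x) I y‖ ≤ C)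
    {x x' y y' : ℝ} (hx : x ∈ I) (hx' : x' ∈ I) (hy : y ∈ I) (hy' : y' ∈ I) :
    ‖(K x' y' - K x' y) - (K x y' - K x y)‖ ≤ C * |y' - y| * |x' - x| := by
  have hK1 := hK.differentiableOn two_ne_zero
  have hd : ∀ s ∈ I, HasDerivWithinAt (fun s => K s y' - K s y)
      (derivWithin (fun s => K s y') I s - derivWithin (fun s => K s y) I s) I s := fun s hs =>
    (hasDerivWithinAt_left hK1 hs hy').differentiableWithinAt.hasDerivWithinAt.sub
      (hasDerivWithinAt_left hK1 hs hy).differentiableWithinAt.hasDerivWithinAt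
  refine hI.norm_image_sub_le_of_norm_hasDerivWithin_le (f := fun s => K s y' - K s y) hd
    (fun s hs => ?_) hx hx'
  exact hI.norm_image_sub_le_of_norm_derivWithin_le
    (differentiableOn_derivWithin_left hI' hK hs) (fun t ht => hC s hs t ht) hy hy'

end Differences

/-! ### The shear and the volume of the close-pair region. -/

/-- The unipotent block matrix that subtracts the first half of the coordinates from the second
half. -/
def pairShear (R : Type*) [CommRing R] (n : ℕ) : Matrix (Fin n ⊕ Fin n) (Fin n ⊕ Fin n) R :=
  Matrix.fromBlocks 1 0 (-1) 1

lemma det_pairShear (R : Type*) [CommRing R] (n : ℕ) : (pairShear R n).det = 1 := by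
  simp [pairShear]

/-- The shear preserves volume and maps the region into a box with n sides of length ℓ and n of
length 2δ. -/
lemma volume_pi_inter_closePairs_sum_le (n : ℕ) (a ℓ δ : ℝ) (hℓ : 0 ≤ ℓ) (hδ : 0 ≤ δ) :
    volume {x : Fin n ⊕ Fin n → ℝ | (∀ i, x (.inl i) ∈ Icc a (a + ℓ)) ∧
      ∀ i, |x (.inl i) - x (.inr i)| ≤ δ} ≤ ENNReal.ofReal ((2 * δ * ℓ) ^ n) := by
  set f := Matrix.toLin' (pairShear ℝ n) with hf
  have hdet : LinearMap.det f = 1 := by rw [hf, LinearMap.det_toLin', det_pairShear]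
  have hinl : ∀ x i, f x (.inl i) = x (.inl i) := fun x i => by
    simp [hf, pairShear, Matrix.fromBlocks_mulVec]
  have hinr : ∀ x i, f x (.inr i) = x (.inr i) - x (.inl i) := fun x i => by
    simp [hf, pairShear, Matrix.fromBlocks_mulVec, Matrix.neg_mulVec]
    ring
  set box : Set (Fin n ⊕ Fin n → ℝ) :=
    univ.pi (Sum.elim (fun _ => Icc a (a + ℓ)) (fun _ => Icc (-δ) δ)) with hbox
  have hsub : {x : Fin n ⊕ Fin n → ℝ | (∀ i, x (.inl i) ∈ Icc a (a + ℓ)) ∧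
      ∀ i, |x (.inl i) - x (.inr i)| ≤ δ} ⊆ f ⁻¹' box := by
    rintro x ⟨h1, h2⟩ (i | i) _
    · simpa [hinl] using h1 i
    · rw [hinr, Sum.elim_inr, mem_Icc, ← abs_le, abs_sub_comm]
      exact h2 i
  refine (measure_mono hsub).trans ?_
  rw [Measure.addHaar_preimage_linearMap volume (by rw [hdet]; exact one_ne_zero), hdet, hbox,
    volume_pi_pi, Fintype.prod_sum_type]
  simp only [inv_one, abs_one, ENNReal.ofReal_one, one_mul, Sum.elim_inl, Sum.elim_inr,
    Real.volume_Icc, Finset.prod_const, Finset.card_univ, Fintype.card_fin]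
  rw [← mul_pow, ← ENNReal.ofReal_mul (by linarith), ← ENNReal.ofReal_pow (by ring_nf; positivity)]
  exact le_of_eq (by ring_nf)

/-! ### The kernel determinant at close pairs. -/

section KernelDeterminant

variable {𝕜 : Type*} [RCLike 𝕜] {I : Set ℝ} {K : ℝ → ℝ → 𝕜} {b δ : ℝ}

lemma norm_det_kernel_sum_le (hI : Convex ℝ I) (hI' : UniqueDiffOn ℝ I) (hb0 : 0 ≤ b)
    (hδ : 0 ≤ δ)
    (hK : ContDiffOn ℝ 2 (fun p : ℝ × ℝ => K p.1 p.2) (I ×ˢ I))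
    (hb : ∀ x ∈ I, ∀ y ∈ I, ‖K x y‖ ≤ b)
    (hbx : ∀ x ∈ I, ∀ y ∈ I, ‖derivWithin (fun s => K s y) I x‖ ≤ b ^ 2)
    (hby : ∀ x ∈ I, ∀ y ∈ I, ‖derivWithin (fun t => K x t) I y‖ ≤ b ^ 2)
    (hbxy : ∀ x ∈ I, ∀ y ∈ I,
      ‖derivWithin (fun t => derivWithin (fun s => K s t) I x) I y‖ ≤ b ^ 3)
    {n : ℕ} {x : Fin n ⊕ Fin n → ℝ} (hx : ∀ i, x i ∈ I)
    (hclose : ∀ i, |x (.inl i) - x (.inr i)| ≤ δ) :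
    ‖(Matrix.of fun i j => K (x i) (x j)).det‖ ≤ (2 * n * b ^ 4 * δ ^ 2) ^ n := by
  set M : Matrix (Fin n ⊕ Fin n) (Fin n ⊕ Fin n) 𝕜 := Matrix.of fun i j => K (x i) (x j) with hM
  set N := pairShear 𝕜 n * M * (pairShear 𝕜 n).transpose with hN
  have hdet : M.det = N.det := by
    rw [hN, Matrix.det_mul, Matrix.det_mul, Matrix.det_transpose, det_pairShear]
    simp
  have hK1 := hK.differentiableOn two_ne_zero
  have hc : ∀ i, |x (.inr i) - x (.inl i)| ≤ δ := fun i => by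
    rw [abs_sub_comm]
    exact hclose i
  -- Weight 1 on first points and bδ on differences: the blocks are bounded by b, b²δ, b²δ and b³δ².
  have hent : ∀ i j, ‖N i j‖ ≤ b * (Sum.elim (fun _ => 1) (fun _ => b * δ) i *
      Sum.elim (fun _ => 1) (fun _ => b * δ) j) := by
    have hblock : N = Matrix.fromBlocks
        (Matrix.of fun i j => K (x (.inl i)) (x (.inl j)))
        (Matrix.of fun i j => K (x (.inl i)) (x (.inr j)) - K (x (.inl i)) (x (.inl j)))
        (Matrix.of fun i j => K (x (.inr i)) (x (.inl j)) - K (x (.inl i)) (x (.inl j)))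
        (Matrix.of fun i j => (K (x (.inr i)) (x (.inr j)) - K (x (.inr i)) (x (.inl j))) -
          (K (x (.inl i)) (x (.inr j)) - K (x (.inl i)) (x (.inl j)))) := by
      rw [hN, ← Matrix.fromBlocks_toBlocks M, pairShear, Matrix.fromBlocks_transpose,
        Matrix.fromBlocks_multiply, Matrix.fromBlocks_multiply]
      congr 1 <;> ext i j <;>
        simp [hM, Matrix.toBlocks₁₁, Matrix.toBlocks₁₂, Matrix.toBlocks₂₁, Matrix.toBlocks₂₂] <;>
        ring
    rw [hblock]
    rintro (i | i) (j | j)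
    · simpa using hb _ (hx _) _ (hx _)
    · have h := norm_sub_right_le hI hK1 hby (hx (.inl i)) (hx (.inl j)) (hx (.inr j))
      calc _ ≤ b ^ 2 * |x (.inr j) - x (.inl j)| := h
        _ ≤ b ^ 2 * δ := by gcongr; exact hc j
        _ = _ := by simp; ring
    · have h := norm_sub_left_le hI hK1 hbx (hx (.inl i)) (hx (.inr i)) (hx (.inl j))
      calc _ ≤ b ^ 2 * |x (.inr i) - x (.inl i)| := h
        _ ≤ b ^ 2 * δ := by gcongr; exact hc i
        _ = _ := by simp; ring
    · have h := norm_mixed_sub_le hI hI' hK hbxy (hx (.inl i)) (hx (.inr i)) (hx (.inl j))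
        (hx (.inr j))
      calc _ ≤ b ^ 3 * |x (.inr j) - x (.inl j)| * |x (.inr i) - x (.inl i)| := h
        _ ≤ b ^ 3 * δ * δ := by gcongr <;> apply hc
        _ = _ := by simp; ring
  have h := Matrix.norm_det_sq_le_of_scaled
    (r := Sum.elim (fun _ => 1) (fun _ => b * δ))
    (by rintro (i | i); exacts [zero_le_one, mul_nonneg hb0 hδ]) hent
  rw [hdet]
  -- Squared, the bound reads (2n·b²)^(2n)·(bδ)^(4n), which is the square of (2nb⁴δ²)^n.
  refine le_of_sq_le_sq (h.trans (le_of_eq ?_)) (by positivity)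
  simp only [Fintype.card_sum, Fintype.card_fin, Fintype.prod_sum_type, Sum.elim_inl, Sum.elim_inr,
    Finset.prod_const, Finset.card_univ, Nat.cast_add, one_pow, one_mul]
  simp only [pow_add, ← mul_pow, pow_right_comm _ n 2]
  congr 1
  ring

lemma norm_det_kernel_le (hI : Convex ℝ I) (hI' : UniqueDiffOn ℝ I) (hb0 : 0 ≤ b) (hδ : 0 ≤ δ)
    (hK : ContDiffOn ℝ 2 (fun p : ℝ × ℝ => K p.1 p.2) (I ×ˢ I))
    (hb : ∀ x ∈ I, ∀ y ∈ I, ‖K x y‖ ≤ b)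
    (hbx : ∀ x ∈ I, ∀ y ∈ I, ‖derivWithin (fun s => K s y) I x‖ ≤ b ^ 2)
    (hby : ∀ x ∈ I, ∀ y ∈ I, ‖derivWithin (fun t => K x t) I y‖ ≤ b ^ 2)
    (hbxy : ∀ x ∈ I, ∀ y ∈ I,
      ‖derivWithin (fun t => derivWithin (fun s => K s t) I x) I y‖ ≤ b ^ 3)
    {n : ℕ} {x : Fin (n + n) → ℝ} (hx : ∀ i, x i ∈ I) (hclose : x ∈ closePairs n δ) :
    ‖(Matrix.of fun i j => K (x i) (x j)).det‖ ≤ (2 * n * b ^ 4 * δ ^ 2) ^ n := by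
  rw [← Matrix.det_submatrix_equiv_self finSumFinEquiv]
  exact norm_det_kernel_sum_le hI hI' hb0 hδ hK hb hbx hby hbxy
    (x := fun i => x (finSumFinEquiv i)) (fun i => hx _) hclose

end KernelDeterminant

/-! ### Integration over close pairs and conclusion. -/

lemma volume_closePairs_inter_pi_le (n : ℕ) {a ℓ δ : ℝ} (hℓ : 0 ≤ ℓ) (hδ : 0 ≤ δ) :
    volume (closePairs n δ ∩ univ.pi fun _ => Icc a (a + ℓ))
      ≤ ENNReal.ofReal ((2 * δ * ℓ) ^ n) := by
  let g := MeasurableEquiv.piCongrLeft (fun _ : Fin n ⊕ Fin n => ℝ) finSumFinEquiv.symm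
  have hg : MeasurePreserving g := volume_measurePreserving_piCongrLeft _ _
  have hgx : ∀ x i, g x i = x (finSumFinEquiv i) := fun x i => by
    conv_lhs => rw [← finSumFinEquiv.symm_apply_apply i]
    exact MeasurableEquiv.piCongrLeft_apply_apply _ _ _
  refine le_trans ?_ (volume_pi_inter_closePairs_sum_le n a ℓ δ hℓ hδ)
  rw [← hg.measure_preimage_equiv]
  refine measure_mono fun x hx => ⟨fun i => ?_, fun i => ?_⟩
  · rw [hgx]
    exact hx.2 _ trivial
  · rw [hgx, hgx]
    exact hx.1 i

/-- The expected number of tuples of `k` distinct points in `B` is at most the volume of `B` inside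
`I ^ k` times a bound for the determinants. -/
lemma IsDeterminantalOn.lintegral_distinctTuples_le {𝕜 : Type*} [RCLike 𝕜] {Ω : Type*}
    [MeasurableSpace Ω] {P : Measure Ω} {I : Set ℝ} (hI : MeasurableSet I) {K : ℝ → ℝ → 𝕜}
    {X : Ω → Finset ℝ} (hX : IsDeterminantalOn P I K X) {k : ℕ} {B : Set (Fin k → ℝ)}
    (hB : MeasurableSet B) {C : ℝ}
    (hC : ∀ x ∈ B, (∀ i, x i ∈ I) → ‖(Matrix.of fun i j => K (x i) (x j)).det‖ ≤ C) :
    ∫⁻ ω, ((distinctTuples (X ω) k B).ncard : ℝ≥0∞) ∂P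
      ≤ ENNReal.ofReal C * volume (B ∩ univ.pi fun _ => I) := by
  obtain ⟨ρ, ⟨-, hρ⟩, hdet⟩ := hX.correlation k
  have hpi : MeasurableSet (univ.pi fun _ : Fin k => I) := MeasurableSet.univ_pi fun _ => hI
  rw [hρ B hB, ← setLIntegral_const]
  refine lintegral_mono_ae ?_
  have h1 := ae_restrict_of_ae_restrict_of_subset (inter_subset_right (s := B)) hdet
  filter_upwards [h1, ae_restrict_mem (hB.inter hpi)] with x hx hxB
  have h := hC x hxB.1 fun i => hxB.2 i trivial
  -- The determinant equals the nonnegative density, so bounding its norm bounds the density.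
  rw [hx, RCLike.norm_of_nonneg (ρ x).coe_nonneg] at h
  rw [← ENNReal.ofReal_coe_nnreal]
  exact ENNReal.ofReal_le_ofReal h

theorem proposition5p5 {𝕜 : Type*} [RCLike 𝕜] {Ω : Type*} [MeasurableSpace Ω]
    (P : Measure Ω) [IsProbabilityMeasure P]
    (a ℓ δ b : ℝ) (hℓ : 0 < ℓ) (hδ : 0 ≤ δ)
    (K : ℝ → ℝ → 𝕜) (X : Ω → Finset ℝ)
    (hX : IsDeterminantalOn P (Icc a (a + ℓ)) K X)
    (hK : ContDiffOn ℝ 2 (fun p : ℝ × ℝ => K p.1 p.2) (Icc a (a + ℓ) ×ˢ Icc a (a + ℓ)))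
    (hb : ∀ x ∈ Icc a (a + ℓ), ∀ y ∈ Icc a (a + ℓ), ‖K x y‖ ≤ b)
    (hbx : ∀ x ∈ Icc a (a + ℓ), ∀ y ∈ Icc a (a + ℓ),
      ‖derivWithin (fun s => K s y) (Icc a (a + ℓ)) x‖ ≤ b ^ 2)
    (hby : ∀ x ∈ Icc a (a + ℓ), ∀ y ∈ Icc a (a + ℓ),
      ‖derivWithin (fun t => K x t) (Icc a (a + ℓ)) y‖ ≤ b ^ 2)
    (hbxy : ∀ x ∈ Icc a (a + ℓ), ∀ y ∈ Icc a (a + ℓ),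
      ‖derivWithin (fun t => derivWithin (fun s => K s t) (Icc a (a + ℓ)) x)
        (Icc a (a + ℓ)) y‖ ≤ b ^ 3)
    (n : ℕ) :
    ∫⁻ ω, ((((jammedPoints δ (X ω)).ncard / 3).choose n * n ! : ℕ) : ℝ≥0∞) ∂P
      ≤ ENNReal.ofReal ((4 * (n : ℝ) * b ^ 4 * δ ^ 3 * ℓ) ^ n) := by
  have ha : a ∈ Icc a (a + ℓ) := ⟨le_rfl, by linarith⟩
  have hb0 : 0 ≤ b := (norm_nonneg _).trans (hb a ha a ha)
  have hI' : UniqueDiffOn ℝ (Icc a (a + ℓ)) := uniqueDiffOn_Icc (by linarith)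
  calc _ ≤ ∫⁻ ω, ((distinctTuples (X ω) (n + n) (closePairs n δ)).ncard : ℝ≥0∞) ∂P :=
        lintegral_mono fun ω => by
          dsimp only
          exact Nat.cast_le.2 <| choose_jammedPoints_mul_factorial_le δ (X ω) n
    _ ≤ ENNReal.ofReal ((2 * n * b ^ 4 * δ ^ 2) ^ n) *
          volume (closePairs n δ ∩ univ.pi fun _ => Icc a (a + ℓ)) :=
        hX.lintegral_distinctTuples_le measurableSet_Icc (measurableSet_closePairs n δ)
          fun x hx hxI => norm_det_kernel_le (convex_Icc _ _) hI' hb0 hδ hK hb hbx hby hbxy hxI hx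
    _ ≤ ENNReal.ofReal ((2 * n * b ^ 4 * δ ^ 2) ^ n) * ENNReal.ofReal ((2 * δ * ℓ) ^ n) := by
        gcongr
        exact volume_closePairs_inter_pi_le n hℓ.le hδ
    _ = _ := by
        rw [← ENNReal.ofReal_mul (by positivity), ← mul_pow]
        congr 2
        ring
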